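/- Let $q(x_1,\dots,x_k)=S_1(\dots),\dots,S_\ell(\dots)$ be a full conjunctive query without self-joins, where $S_j$ has arity $a_j\ge 1$. Relation $S_j$ consists of $m_j$ tuples over a domain of $n\ge 2$ values and has size $M_j=a_j m_j\lceil\log_2 n\rceil$ bits; let $\mathbf M=(M_1,\dots,M_\ell)$. **Residual queries.** For $\mathbf x\subseteq \mathrm{vars}(q)$, the residual query $q_{\mathbf x}$ arises from $q$ by deleting the variables in $\mathbf x$ and then the atoms without remaining variables. A fractional edge packing of $q_{\mathbf x}$ assigns a weight $u_j\ge 0$ to each of its atoms (and $u_j=0$ to the other atoms of $q$) such that for each variable $v\notin\mathbf x$ the weights of the atoms containing $v$ sum to at most $1$. Put $$L^{(q_{\mathbf x})}(\mathbf M,p)=\max_{u}\Bigl(\tfrac{\prod_j M_j^{u_j}}{p}\Bigr)^{1/\sum_j u_j},\qquad \psi^*(q)=\max_{\mathbf x\subseteq \mathrm{vars}(q)}\ \max_{u}\sum_j u_j ,$$ where $u$ ranges over the fractional edge packings of $q_{\mathbf x}$, with $u\neq 0$ in the first maximum (which is $0$ if $q_{\mathbf x}$ has no atoms). Let $L_{\max}=\max_{\mathbf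 x\subseteq \mathrm{vars}(q)}L^{(q_{\mathbf x})}(\mathbf M,p)$. **Model.** The input tuples are distributed arbitrarily among $p$ servers, and all servers know the sizes, a common random seed, and the heavy hitters, i.e. the values that occur at some position of some $S_j$ with frequency at least $m_j/p$. In one round every server sends a bit string to every server; then every server computes an output from what it knows and has received. The output of the algorithm is the union of these outputs, and its maximum load is the largest number of bits received by a server. **Algorithm.** A value is heavy at a variable $v$ if it is a heavy hitter at a position of $v$ in at least one atom. For each $\mathbf x\subseteq\mathrm{vars}(q)$ choose shares $p^{\mathbf x}_1,\dots,p^{\mathbf x}_k\ge 1$ with $\prod_i p^{\mathbf x}_i\le p$ and $p_i^{\mathbf x}=1$ for $x_i\in\mathbf x$, identify the points of $\prod_i[p_i^{\mathbf x}]$ with distinct servers, and choose independent uniformly random hash functions $h_i^{\mathbf x}:[n]\to[p_i^{\mathbf x}]$. In parallel for all $\mathbf x$, each tuple $t$ of $S_j$ whose values are heavy at exactly those variables of $S_j$ that lie in $\mathbf x$ is sent to all points $y$ with $y_i=h^{\mathbf x}_i(t[x_i])$ for all $x_i\in\mathrm{vars}(S_j)$. Each server then evaluates $q$ on the tuples it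 has received. **Theorem.** For every $q$, the shares and the identifications can be chosen, depending only on $q,p,n,(m_j)_j$, and there is a constant $c$ depending only on $q$, such that for every $\gamma>0$ there is a constant $C$ depending only on $q$ and $\gamma$ with the following property. Let $p\ge 1$ and suppose that $a_j\,p^{a_j}\lceil\log_2 n\rceil\le L_{\max}$ for all $j$ (the size of $p^{a_j}$ tuples of $S_j$ does not exceed the load bound). Then on every input with these relation sizes, and for every initial distribution of it, this one-round algorithm always outputs exactly the answer of $q$, and with probability at least $1-p^{-\gamma}$ its maximum load is at most $$C\,(1+\log p)^c\cdot\max_{\mathbf x\subseteq \mathrm{vars}(q)}L^{(q_{\mathbf x})}(\mathbf M,p).$$ If all $M_j$ equal $M$, then with probability at least $1-p^{-\gamma}$ the maximum load is at most $C\,(1+\log p)^c\cdot M/p^{1/\psi^*(q)}$. -/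

import Mathlib

open scoped BigOperators

/-- A full conjunctive query without self-joins `q(x₁,…,x_k) = S₁(…),…,S_ℓ(…)`: the variables are
`Fin k`, the relation symbols (= atoms) are `Fin ℓ`, and `atom j r` is the variable at position `r`
of the atom `S_j`. Repeated variables inside an atom are allowed. -/
structure FullCQ (k ℓ : ℕ) where
  arity : Fin ℓ → ℕ
  arity_pos : ∀ j, 0 < arity j
  atom : ∀ j, Fin (arity j) → Fin k
  /-- every variable occurs in some atom -/
  covers : ∀ v, ∃ j r, atom j r = v

namespace FullCQ

variable {k ℓ : ℕ}

/-! ### Packings of residual queries and the load bound -/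

/-- `vars(S_j)`. -/
def vars (q : FullCQ k ℓ) (j : Fin ℓ) : Finset (Fin k) :=
  Finset.univ.image (q.atom j)

/-- The variables of `S_j` in the residual query `q_x`, which arises by removing the variables
in `x`. -/
def residualVars (q : FullCQ k ℓ) (x : Finset (Fin k)) (j : Fin ℓ) : Finset (Fin k) :=
  q.vars j \ x

/-- The atoms of the residual query `q_x`: those whose arity does not drop to zero. -/
def residualAtoms (q : FullCQ k ℓ) (x : Finset (Fin k)) : Finset (Fin ℓ) :=
  Finset.univ.filter fun j => (q.residualVars x j).Nonempty

/-- `u ∈ pk(q_x)`: `u` is a fractional edge packing of the residual query `q_x`; the atoms that are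
not atoms of `q_x` get weight `0`. -/
def IsResidualPacking (q : FullCQ k ℓ) (x : Finset (Fin k)) (u : Fin ℓ → ℝ) : Prop :=
  (∀ j, 0 ≤ u j) ∧ (∀ j, j ∉ q.residualAtoms x → u j = 0) ∧
    ∀ v, v ∉ x →
      ∑ j ∈ (q.residualAtoms x).filter (fun j => v ∈ q.residualVars x j), u j ≤ 1

/-- The edge quasi-packing number `ψ*(q)`. -/
noncomputable def quasiPackingNumber (q : FullCQ k ℓ) : ℝ :=
  sSup {s | ∃ x u, q.IsResidualPacking x u ∧ s = ∑ j, u j}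

/-- `L(u, M, p) = (∏_j M_j^{u_j} / p)^{1 / ∑_j u_j}` (meaningful for `u ≠ 0`). -/
noncomputable def packingLoad (u : Fin ℓ → ℝ) (M : Fin ℓ → ℝ) (p : ℕ) : ℝ :=
  ((∏ j, M j ^ u j) / (p : ℝ)) ^ (1 / ∑ j, u j)

/-- `L^{(q_x)}(M, p)`, the maximum of `L(u, M, p)` over the nonzero packings `u` of `q_x`. It is `0`
if `q_x` has no atoms. (For `p ≥ 1`, `M ≥ 0` the values are bounded by `max_j M_j`.) -/
noncomputable def residualLoad (q : FullCQ k ℓ) (x : Finset (Fin k)) (M : Fin ℓ → ℝ) (p : ℕ) : ℝ :=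
  sSup {L | ∃ u, q.IsResidualPacking x u ∧ u ≠ 0 ∧ L = packingLoad u M p}

/-- `max_{x ⊆ vars(q)} L^{(q_x)}(M, p)`. -/
noncomputable def maxResidualLoad (q : FullCQ k ℓ) (M : Fin ℓ → ℝ) (p : ℕ) : ℝ :=
  ⨆ x : Finset (Fin k), q.residualLoad x M p

/-! ### Databases and answers -/

/-- Tuples of the relation `S_j` over the domain `Fin n`. -/
abbrev Tuple (q : FullCQ k ℓ) (n : ℕ) (j : Fin ℓ) : Type := Fin (q.arity j) → Fin n

/-- A database instance: one finite relation for each relation symbol. -/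
abbrev Database (q : FullCQ k ℓ) (n : ℕ) : Type := ∀ j, Finset (q.Tuple n j)

/-- The answer `q(I)`: all assignments of the variables that satisfy every atom. -/
def answer (q : FullCQ k ℓ) {n : ℕ} (I : q.Database n) : Finset (Fin k → Fin n) :=
  Finset.univ.filter fun t => ∀ j, (fun r => t (q.atom j r)) ∈ I j

/-- The size in bits `M_j = a_j m_j ⌈log₂ n⌉` of a relation `S_j` with `m_j` tuples. -/
def sizeBits (q : FullCQ k ℓ) (n : ℕ) (m : Fin ℓ → ℕ) (j : Fin ℓ) : ℕ :=
  q.arity j * m j * Nat.clog 2 n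

/-- Sets of values, one for each position of each relation. -/
abbrev HeavyInfo (q : FullCQ k ℓ) (n : ℕ) : Type := ∀ j, Fin (q.arity j) → Finset (Fin n)

/-- The heavy hitters: the values that occur at position `r` of `S_j` with frequency at least
`m_j / p`. -/
def heavyHitters (q : FullCQ k ℓ) {n : ℕ} (p : ℕ) (I : q.Database n) : q.HeavyInfo n := fun j r =>
  Finset.univ.filter fun h =>
    0 < ((I j).filter fun t => t r = h).card ∧
      (I j).card ≤ p * ((I j).filter fun t => t r = h).card

/-- The value `h` is heavy at the variable `v`: it is a heavy hitter at `v` in at least one atom. -/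
def HeavyAt (q : FullCQ k ℓ) {n : ℕ} (H : q.HeavyInfo n) (v : Fin k) (h : Fin n) : Prop :=
  ∃ j r, q.atom j r = v ∧ h ∈ H j r

/-! ### One-round algorithms in the MPC model -/

/-- A randomized one-round MPC algorithm for `q` on `p` servers, domain size `n`. The public random
seed is uniform on a finite set. In the communication phase the sender `s` computes, from the seed,
the heavy hitters (known to all servers) and its own part of the input, a bit string for each
receiver. Then each server computes its output from what it knows and the strings received. -/
structure OneRoundAlgorithm (q : FullCQ k ℓ) (n p : ℕ) where
  Seed : Type
  [seedFintype : Fintype Seed]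
  [seedNonempty : Nonempty Seed]
  send : Seed → q.HeavyInfo n → (sender : Fin p) → q.Database n → (receiver : Fin p) → List Bool
  output : Seed → q.HeavyInfo n → (server : Fin p) → q.Database n → (Fin p → List Bool) →
    Finset (Fin k → Fin n)

attribute [instance] OneRoundAlgorithm.seedFintype OneRoundAlgorithm.seedNonempty

/-- A partition of the potential input tuples among the servers. -/
abbrev Placement (q : FullCQ k ℓ) (n p : ℕ) : Type := ∀ j, q.Tuple n j → Fin p

/-- The part of the database `I` that is initially stored at server `s`. -/
def fragment (q : FullCQ k ℓ) {n p : ℕ} (I : q.Database n) (owner : q.Placement n p) (s : Fin p) :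
    q.Database n :=
  fun j => (I j).filter fun t => owner j t = s

namespace OneRoundAlgorithm

variable {q : FullCQ k ℓ} {n p : ℕ}

/-- The bit string that `s` sends to `s'`. -/
def message (A : OneRoundAlgorithm q n p) (I : q.Database n) (owner : q.Placement n p)
    (ω : A.Seed) (s s' : Fin p) : List Bool :=
  A.send ω (q.heavyHitters p I) s (q.fragment I owner s) s'

/-- The union of the outputs of all servers. -/
def result (A : OneRoundAlgorithm q n p) (I : q.Database n) (owner : q.Placement n p)
    (ω : A.Seed) : Finset (Fin k → Fin n) :=
  Finset.univ.biUnion fun s' => A.output ω (q.heavyHitters p I) s' (q.fragment I owner s')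
    fun s => A.message I owner ω s s'

/-- The maximum number of bits that a server receives. -/
def maxLoad (A : OneRoundAlgorithm q n p) (I : q.Database n) (owner : q.Placement n p)
    (ω : A.Seed) : ℕ :=
  Finset.univ.sup fun s' => ∑ s, (A.message I owner ω s s').length

/-- The probability of an event under the uniformly random seed. -/
noncomputable def prob (A : OneRoundAlgorithm q n p) (E : A.Seed → Prop) : ℝ :=
  (Nat.card {ω // E ω} : ℝ) / (Nat.card A.Seed : ℝ)

end OneRoundAlgorithm

/-! ### Bit encoding of sets of tuples -/

/-- The binary code of a value, with `⌈log₂ n⌉` bits. -/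
def encodeValue {n : ℕ} (h : Fin n) : List Bool :=
  List.ofFn fun i : Fin (Nat.clog 2 n) => h.val.testBit i

/-- The code of a tuple of `S_j`: the index `j` in unary and the codes of the values. -/
def encodeTuple (q : FullCQ k ℓ) {n : ℕ} (f : Σ j, q.Tuple n j) : List Bool :=
  List.replicate f.1 true ++ false :: (List.ofFn fun r => encodeValue (f.2 r)).flatten

/-- The code of a set of tuples: the concatenation of the codes of its elements. -/
noncomputable def encode (q : FullCQ k ℓ) {n : ℕ} (F : q.Database n) : List Bool :=
  ((Finset.univ.sigma F).toList.map q.encodeTuple).flatten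

open Classical in
/-- The inverse of `encode`. -/
noncomputable def decode (q : FullCQ k ℓ) {n : ℕ} (w : List Bool) : q.Database n :=
  if h : ∃ F : q.Database n, q.encode F = w then h.choose else fun _ => ∅

theorem encodeValue_inj {n : ℕ} (a b : Fin n) (h : encodeValue a = encodeValue b) : a = b := by
  have h2 := List.ofFn_injective h
  apply Fin.ext
  apply Nat.eq_of_testBit_eq
  intro i
  by_cases hi : i < Nat.clog 2 n
  · exact congrFun h2 ⟨i, hi⟩
  · have hn : n ≤ 2 ^ i := le_trans (Nat.le_pow_clog (by norm_num) n) (Nat.pow_le_pow_right (by norm_num) (by omega))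
    rw [Nat.testBit_lt_two_pow (lt_of_lt_of_le a.2 hn), Nat.testBit_lt_two_pow (lt_of_lt_of_le b.2 hn)]

theorem encodeBlock_inj {α : Type} (L : ℕ) : ∀ {a : ℕ} (f g : Fin a → List α) (s t : List α),
    (∀ i, (f i).length = L) → (∀ i, (g i).length = L) →
    (List.ofFn f).flatten ++ s = (List.ofFn g).flatten ++ t → f = g ∧ s = t := by
  intro a
  induction a with
  | zero => intro f g s t _ _ h; simp at h; exact ⟨funext fun i => i.elim0, h⟩
  | succ a ih =>
    intro f g s t hf hg h
    simp only [List.ofFn_succ, List.flatten_cons, List.append_assoc] at h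
    obtain ⟨h1, h2⟩ := List.append_inj h (by rw [hf, hg])
    obtain ⟨h3, h4⟩ := ih (fun i => f i.succ) (fun i => g i.succ) s t (fun i => hf _) (fun i => hg _) h2
    refine ⟨funext fun i => ?_, h4⟩
    refine Fin.cases h1 (fun i => congrFun h3 i) i

theorem encodeUnary_inj : ∀ (i j : ℕ) (s t : List Bool), List.replicate i true ++ false :: s = List.replicate j true ++ false :: t → i = j ∧ s = t
  | 0, 0, s, t, h => by simpa using h
  | 0, j+1, s, t, h => by simp [List.replicate_succ] at h
  | i+1, 0, s, t, h => by simp [List.replicate_succ] at h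
  | i+1, j+1, s, t, h => by
    simp only [List.replicate_succ, List.cons_append, List.cons.injEq, true_and] at h
    obtain ⟨h1, h2⟩ := encodeUnary_inj i j s t h
    exact ⟨by omega, h2⟩

theorem encodeTuple_inj (q : FullCQ k ℓ) {n : ℕ} (f g : Σ j, q.Tuple n j) (s t : List Bool)
    (h : q.encodeTuple f ++ s = q.encodeTuple g ++ t) : f = g ∧ s = t := by
  obtain ⟨i, f⟩ := f; obtain ⟨j, g⟩ := g
  simp only [encodeTuple, List.append_assoc, List.cons_append] at h
  obtain ⟨h1, h2⟩ := encodeUnary_inj _ _ _ _ h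
  obtain rfl : i = j := Fin.ext h1
  obtain ⟨h3, h4⟩ := encodeBlock_inj (Nat.clog 2 n) _ _ s t (by simp [encodeValue]) (by simp [encodeValue]) h2
  refine ⟨?_, h4⟩
  congr 1
  funext r
  exact encodeValue_inj _ _ (congrFun h3 r)

theorem encodeList_inj (q : FullCQ k ℓ) {n : ℕ} : ∀ (a b : List (Σ j, q.Tuple n j)),
    (a.map q.encodeTuple).flatten = (b.map q.encodeTuple).flatten → a = b
  | [], [], _ => rfl
  | [], g :: b, h => by simp [encodeTuple] at h
  | f :: a, [], h => by simp [encodeTuple] at h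
  | f :: a, g :: b, h => by
    simp only [List.map_cons, List.flatten_cons] at h
    obtain ⟨rfl, h2⟩ := encodeTuple_inj q f g _ _ h
    rw [encodeList_inj q a b h2]

theorem decode_encode (q : FullCQ k ℓ) {n : ℕ} (F : q.Database n) : q.decode (q.encode F) = F := by
  have h : ∃ G : q.Database n, q.encode G = q.encode F := ⟨F, rfl⟩
  rw [decode, dif_pos h]
  have h1 := encodeList_inj q _ _ h.choose_spec
  have h2 : Finset.univ.sigma h.choose = Finset.univ.sigma F := by
    ext z
    rw [← Finset.mem_toList, h1, Finset.mem_toList]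
  funext j
  ext t
  have := congrArg (fun s => (⟨j, t⟩ : Σ j, q.Tuple n j) ∈ s) h2
  simpa using this

/-! ### The HyperCube algorithm with one instance for each set of heavy variables -/

/-- The parameters: for each set `x` of variables, the shares of a HyperCube instance, with share `1`
for the variables in `x`, and an injection of the points of its hypercube into the `p` servers (so
that the product of the shares is at most `p`). -/
structure HyperCubeFamily (k p : ℕ) where
  share : Finset (Fin k) → Fin k → ℕ
  share_pos : ∀ x v, 0 < share x v
  share_heavy : ∀ x, ∀ v ∈ x, share x v = 1
  server : ∀ x, (∀ v, Fin (share x v)) ↪ Fin p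

/-- One hash function for each instance `x` and each variable `v`. -/
abbrev HashFamily {p : ℕ} (S : HyperCubeFamily k p) (n : ℕ) : Type :=
  ∀ x v, Fin n → Fin (S.share x v)

/-- The tuple `t` of `S_j` is sent to server `s` if this is so in the HyperCube instance of some set
`x`. The instance `x` handles the tuples whose values are heavy exactly at the variables in `x`, and
sends `t` to the points `y` of the hypercube that agree with the hash values of `t`. -/
def SentTo (q : FullCQ k ℓ) {n p : ℕ} (S : HyperCubeFamily k p) (ω : HashFamily S n)
    (H : q.HeavyInfo n) (j : Fin ℓ) (t : q.Tuple n j) (s : Fin p) : Prop :=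
  ∃ x : Finset (Fin k), (∀ r, q.HeavyAt H (q.atom j r) (t r) ↔ q.atom j r ∈ x) ∧
    ∃ y : ∀ v, Fin (S.share x v), S.server x y = s ∧
      ∀ r, ω x (q.atom j r) (t r) = y (q.atom j r)

open Classical in
/-- The algorithm that runs all the HyperCube instances in parallel, with independent uniformly
random hash functions; afterwards each server evaluates `q` on the tuples it has received. -/
noncomputable def hyperCube (q : FullCQ k ℓ) (n : ℕ) {p : ℕ} (S : HyperCubeFamily k p) :
    OneRoundAlgorithm q n p where
  Seed := HashFamily S n
  seedNonempty := ⟨fun x v _ => ⟨0, S.share_pos x v⟩⟩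
  send ω H _ F s' := q.encode fun j => (F j).filter fun t => q.SentTo S ω H j t s'
  output _ _ _ _ w := q.answer fun j => Finset.univ.biUnion fun s => q.decode (w s) j

end FullCQ

/-!
The algorithm is correct because an answer `t` is assembled at a server that can be named: if `x` is
the set of variables at which `t` is heavy, then every atom's tuple of `t` is sent, in the instance
of `x`, to the point of the hypercube given by the hash values of `t` (`hyperCube_result`).

For the load, fix an instance `x` and an atom `S_j`.

* If all variables of `S_j` lie in `x`, the tuples concerned have heavy values only. A position has
  at most `p` heavy hitters, so there are `O(p ^ a_j)` such tuples, and their size is at most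
  a constant times the load bound by hypothesis
  (`card_patternTuples_le_of_residualVars_eq_empty`).
* Otherwise the tuples are light at the variables `V = vars(S_j) \ x`. Let `P` be the product of the
  shares of `V`, so that `P ≤ p`, and let `N` be the number of tuples that are hashed to a given
  point. The moments of `N` are bounded one factor at a time. Condition on given tuples
  `t₁, …, t_d` being hashed to the point. A tuple that shares no value with them is hashed to the
  point with conditional probability `1 / P` (`card_hash_eq_mul_prod_le`), and at most
  `|V| d m_j / p ≤ |V| d m_j / P` tuples share a value with them, because light values have
  frequency below `m_j / p`. Hence `E[N ^ D] ≤ K ^ D` with `K = (m_j / P) (1 + |V| D)`, and Markov's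
  inequality gives `Pr[N > e K] ≤ exp (-D)` (`card_hash_count_gt_le`). A value of `D` of order
  `log p` suffices for a union bound over all hypercube points, so that a single logarithmic factor
  is lost.

It remains to choose the shares with `M_j / P = O(L^{(q_x)})` for all `j`. By linear programming
duality there are exponents `f ≥ 0` with `∑ v, f v ≤ log p` and
`log M_j - ∑ v ∈ V, f v ≤ log (2 L^{(q_x)})`, and the shares are the numbers `exp (f v)`, rounded
down (`exists_share_exponents`, `exists_hyperCubeFamily`). For equal sizes `M_j = M`, the load of a
packing `u` is `M / p ^ (1 / ∑ u_j) ≤ M / p ^ (1 / ψ*)` (`maxResidualLoad_le_of_le`).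
-/

namespace FullCQ

variable {k ℓ : ℕ}

/-! ### Concentration of the number of tuples hashed to a point -/

open Classical in
/-- A conditional moment bound for the number of the events `A t`, `t ∈ T`, that occur: if, given
fewer than `D` of the events, the conditional expectation of this number is at most `K`, then its
conditional `d`-th moment given `L` is at most `K ^ d`, as long as `|L| + d ≤ D`. -/
theorem sum_pow_count_le {Ω τ : Type*} [Fintype Ω] (A : τ → Ω → Prop) (T : Finset τ) {K : ℝ}
    (hK : 0 ≤ K) (D : ℕ)
    (h : ∀ L : List τ, L.length < D → (∀ t ∈ L, t ∈ T) →
      ∑ t ∈ T, ((Finset.univ.filter fun ω => (∀ s ∈ L, A s ω) ∧ A t ω).card : ℝ) ≤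
        K * (Finset.univ.filter fun ω => ∀ s ∈ L, A s ω).card) :
    ∀ (d : ℕ) (L : List τ), L.length + d ≤ D → (∀ t ∈ L, t ∈ T) →
      ∑ ω ∈ Finset.univ.filter (fun ω => ∀ s ∈ L, A s ω), ((T.filter fun t => A t ω).card : ℝ) ^ d ≤
        K ^ d * (Finset.univ.filter fun ω => ∀ s ∈ L, A s ω).card := by
  intro d
  induction d with
  | zero => intro L _ _; simp
  | succ d ih =>
    intro L hL hLT
    calc ∑ ω ∈ Finset.univ.filter (fun ω => ∀ s ∈ L, A s ω),
          ((T.filter fun t => A t ω).card : ℝ) ^ (d + 1)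
        = ∑ ω ∈ Finset.univ.filter (fun ω => ∀ s ∈ L, A s ω), ∑ t ∈ T,
            if A t ω then ((T.filter fun t => A t ω).card : ℝ) ^ d else 0 := by
          refine Finset.sum_congr rfl fun ω _ => ?_
          rw [← Finset.sum_filter, Finset.sum_const, nsmul_eq_mul, pow_succ, mul_comm]
      _ = ∑ t ∈ T, ∑ ω ∈ Finset.univ.filter (fun ω => ∀ s ∈ t :: L, A s ω),
            ((T.filter fun t => A t ω).card : ℝ) ^ d := by
          rw [Finset.sum_comm]
          refine Finset.sum_congr rfl fun t _ => ?_
          rw [← Finset.sum_filter, Finset.filter_filter]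
          simp only [List.forall_mem_cons, and_comm]
      _ ≤ ∑ t ∈ T, K ^ d * (Finset.univ.filter fun ω => ∀ s ∈ t :: L, A s ω).card := by
          refine Finset.sum_le_sum fun t ht => ih _ ?_ ?_
          · simp only [List.length_cons]; omega
          · simpa using ⟨ht, hLT⟩
      _ ≤ K ^ d * (K * (Finset.univ.filter fun ω => ∀ s ∈ L, A s ω).card) := by
          rw [← Finset.mul_sum]
          refine mul_le_mul_of_nonneg_left (le_trans (le_of_eq ?_) (h L (by omega) hLT))
            (pow_nonneg hK d)
          simp only [List.forall_mem_cons, and_comm]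
      _ = _ := by ring

open Classical in
/-- Markov's inequality for the `D`-th moment of the number of the events `A t`, `t ∈ T`, that
occur. -/
theorem card_count_gt_le {Ω τ : Type*} [Fintype Ω] (A : τ → Ω → Prop) (T : Finset τ) {K : ℝ}
    (hK : 0 ≤ K) (D : ℕ)
    (h : ∀ L : List τ, L.length < D → (∀ t ∈ L, t ∈ T) →
      ∑ t ∈ T, ((Finset.univ.filter fun ω => (∀ s ∈ L, A s ω) ∧ A t ω).card : ℝ) ≤
        K * (Finset.univ.filter fun ω => ∀ s ∈ L, A s ω).card) :
    ((Finset.univ.filter fun ω => Real.exp 1 * K < ((T.filter fun t => A t ω).card : ℝ)).card : ℝ)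
      ≤ Real.exp (-(D : ℝ)) * Fintype.card Ω := by
  set B := Finset.univ.filter fun ω => Real.exp 1 * K < ((T.filter fun t => A t ω).card : ℝ)
  have hm : ∑ ω : Ω, ((T.filter fun t => A t ω).card : ℝ) ^ D ≤ K ^ D * Fintype.card Ω := by
    simpa using sum_pow_count_le A T hK D h D [] (by simp) (by simp)
  rcases Nat.eq_zero_or_pos D with rfl | hD
  · simpa using Finset.card_le_univ B
  rcases hK.eq_or_lt with rfl | hK
  · have hB : B = ∅ := by
      refine Finset.filter_eq_empty_iff.2 fun ω _ hω => ?_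
      rw [mul_zero] at hω
      have h1 := Finset.single_le_sum (f := fun ω => ((T.filter fun t => A t ω).card : ℝ) ^ D)
        (fun _ _ => by positivity) (Finset.mem_univ ω)
      have h2 := pow_pos hω D
      rw [zero_pow hD.ne', zero_mul] at hm
      linarith
    rw [hB]
    simpa using by positivity
  · have h1 : (B.card : ℝ) * (Real.exp 1 * K) ^ D ≤ K ^ D * Fintype.card Ω := by
      refine le_trans ?_ hm
      rw [← nsmul_eq_mul]
      refine le_trans (Finset.card_nsmul_le_sum B
        (fun ω => ((T.filter fun t => A t ω).card : ℝ) ^ D) _ fun ω hω => ?_)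
        (Finset.sum_le_univ_sum_of_nonneg fun _ => by positivity)
      exact pow_le_pow_left₀ (by positivity) (Finset.mem_filter.1 hω).2.le D
    have h2 : Real.exp 1 ^ D = Real.exp D := by rw [← Real.exp_nat_mul, mul_one]
    rw [mul_pow, h2] at h1
    rw [Real.exp_neg, inv_mul_eq_div, le_div_iff₀ (Real.exp_pos _)]
    have : 0 < K ^ D := by positivity
    nlinarith

/-- The hash functions of the instance `x` map the assignment `t` to the point `y`, as far as the
variables in `V` are concerned. -/
def HashesTo {p n : ℕ} (S : HyperCubeFamily k p) (x V : Finset (Fin k))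
    (y : ∀ v, Fin (S.share x v)) (t : Fin k → Fin n) (ω : HashFamily S n) : Prop :=
  ∀ v ∈ V, ω x v (t v) = y v

open Classical in
/-- Resampling the hash values of `t` at the variables in `V`: an event `B` that does not depend on
these values is independent of the event that `t` is hashed to `y`, which has probability
`∏ v ∈ V, 1 / share x v`. -/
theorem card_hash_eq_mul_prod_le {p n : ℕ} (S : HyperCubeFamily k p) (x : Finset (Fin k))
    (V : Finset (Fin k)) (y : ∀ v, Fin (S.share x v)) (t : Fin k → Fin n)
    (B : HashFamily S n → Prop)
    (hB : ∀ ω ω' : HashFamily S n,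
      (∀ v a, (v ∈ V → a ≠ t v) → ω x v a = ω' x v a) → B ω → B ω') :
    (Finset.univ.filter fun ω => B ω ∧ HashesTo S x V y t ω).card * ∏ v ∈ V, S.share x v ≤
      (Finset.univ.filter fun ω => B ω).card := by
  -- Replacing the hash values of `t` in all possible ways embeds the product into `B`.
  let re : HashFamily S n × (∀ v : V, Fin (S.share x v)) → HashFamily S n := fun a =>
    Function.update a.1 x fun v b =>
      if h : v ∈ V ∧ b = t v then a.2 ⟨v, h.1⟩ else a.1 x v b
  have hcard : ∏ v ∈ V, S.share x v =
      (Finset.univ : Finset (∀ v : V, Fin (S.share x v))).card := by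
    rw [Finset.card_univ, Fintype.card_pi]
    simpa using (Finset.prod_coe_sort V fun v => S.share x v).symm
  rw [hcard, ← Finset.card_product]
  refine Finset.card_le_card_of_injOn re ?_ ?_
  · rintro ⟨ω, z⟩ hω
    simp only [Finset.coe_product, Finset.coe_filter, Finset.mem_univ, true_and, Set.mem_prod,
      Set.mem_ofPred_eq, Finset.coe_univ, Set.mem_univ, and_true] at hω ⊢
    refine hB ω _ (fun v a hva => ?_) hω.1
    simp only [re, Function.update_self]
    rw [dif_neg]
    exact fun h => hva h.1 h.2
  · rintro ⟨ω, z⟩ hω ⟨ω', z'⟩ hω' heq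
    simp only [Finset.coe_product, Finset.coe_filter, Finset.mem_univ, true_and, Set.mem_prod,
      Set.mem_ofPred_eq, Finset.coe_univ, Set.mem_univ, and_true] at hω hω'
    have hx := congrFun heq x
    simp only [re, Function.update_self] at hx
    refine Prod.ext ?_ ?_
    · funext x' v a
      by_cases hxx : x' = x
      · subst hxx
        by_cases hva : v ∈ V ∧ a = t v
        · obtain ⟨hv, rfl⟩ := hva
          exact (hω.2 v hv).trans (hω'.2 v hv).symm
        · simpa [hva] using congrFun (congrFun hx v) a
      · simpa [re, hxx] using congrFun (congrFun (congrFun heq x') v) a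
    · funext ⟨v, hv⟩
      simpa [hv] using congrFun (congrFun hx v) (t v)

open Classical in
/-- Tuples without frequent values spread evenly: if no value occurs in more than `m / p` of the
at most `m` tuples, then no point of the hypercube receives much more than its fair share
`m / ∏ v ∈ V, share x v`. -/
theorem card_hash_count_gt_le {p n : ℕ} (hp : 0 < p) (S : HyperCubeFamily k p)
    (x V : Finset (Fin k)) (y : ∀ v, Fin (S.share x v)) {τ : Type*} (F : τ → Fin k → Fin n)
    (T : Finset τ) (m : ℕ) (hT : T.card ≤ m) (hV : ∏ v ∈ V, S.share x v ≤ p)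
    (hfreq : ∀ s ∈ T, ∀ v ∈ V, p * (T.filter fun t => F t v = F s v).card ≤ m) (D : ℕ) :
    ((Finset.univ.filter fun ω : HashFamily S n =>
        Real.exp 1 * ((m : ℝ) / ((∏ v ∈ V, S.share x v : ℕ) : ℝ) * (1 + V.card * D)) <
          ((T.filter fun t => HashesTo S x V y (F t) ω).card : ℝ)).card : ℝ) ≤
      Real.exp (-(D : ℝ)) * Fintype.card (HashFamily S n) := by
  set P := ∏ v ∈ V, S.share x v with hP
  have hP0 : 0 < P := Finset.prod_pos fun v _ => S.share_pos x v
  have hP0' : (0 : ℝ) < P := by exact_mod_cast hP0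
  have hp0' : (0 : ℝ) < p := by exact_mod_cast hp
  refine card_count_gt_le (fun t ω => HashesTo S x V y (F t) ω) T (by positivity) D ?_
  intro L hL hLT
  set b : ℝ := ((Finset.univ.filter fun ω => ∀ s ∈ L, HashesTo S x V y (F s) ω).card : ℝ) with hb
  have hb0 : 0 ≤ b := by positivity
  -- The tuples that share a value with a tuple of `L`.
  set Q : Finset τ := T.filter fun t => ∃ s ∈ L, ∃ v ∈ V, F t v = F s v with hQ
  have hQcard : (Q.card : ℝ) ≤ V.card * D * (m / P) := by
    have h1 : Q ⊆ L.toFinset.biUnion fun s => V.biUnion fun v => T.filter fun t => F t v = F s v := by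
      intro t ht
      obtain ⟨htT, s, hs, v, hv, he⟩ := Finset.mem_filter.1 ht
      simp only [Finset.mem_biUnion, List.mem_toFinset, Finset.mem_filter]
      exact ⟨s, hs, v, hv, htT, he⟩
    have h2 : ∀ s ∈ L.toFinset, ((V.biUnion fun v => T.filter fun t => F t v = F s v).card : ℝ) ≤
        V.card * (m / P) := by
      intro s hs
      have h3 : ∀ v ∈ V, ((T.filter fun t => F t v = F s v).card : ℝ) ≤ m / P := by
        intro v hv
        have h4 := hfreq s (hLT s (List.mem_toFinset.1 hs)) v hv
        rw [le_div_iff₀ hP0']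
        have h5 : (T.filter fun t => F t v = F s v).card * P ≤ m :=
          le_trans (by rw [mul_comm]; exact Nat.mul_le_mul_right _ hV) h4
        exact_mod_cast h5
      calc ((V.biUnion fun v => T.filter fun t => F t v = F s v).card : ℝ)
          ≤ ∑ v ∈ V, ((T.filter fun t => F t v = F s v).card : ℝ) := by
            exact_mod_cast Finset.card_biUnion_le
        _ ≤ ∑ v ∈ V, (m : ℝ) / P := Finset.sum_le_sum h3
        _ = V.card * (m / P) := by rw [Finset.sum_const, nsmul_eq_mul]
    calc (Q.card : ℝ) ≤ ((L.toFinset.biUnion fun s => V.biUnion fun v =>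
            T.filter fun t => F t v = F s v).card : ℝ) := by exact_mod_cast Finset.card_le_card h1
      _ ≤ ∑ s ∈ L.toFinset, ((V.biUnion fun v => T.filter fun t => F t v = F s v).card : ℝ) := by
            exact_mod_cast Finset.card_biUnion_le
      _ ≤ ∑ s ∈ L.toFinset, (V.card : ℝ) * (m / P) := Finset.sum_le_sum h2
      _ = L.toFinset.card * (V.card * (m / P)) := by rw [Finset.sum_const, nsmul_eq_mul]
      _ ≤ D * (V.card * (m / P)) := by
            refine mul_le_mul_of_nonneg_right ?_ (by positivity)
            exact_mod_cast (List.toFinset_card_le L).trans hL.le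
      _ = V.card * D * (m / P) := by ring
  have hstep : ∀ t ∈ T, ((Finset.univ.filter fun ω =>
        (∀ s ∈ L, HashesTo S x V y (F s) ω) ∧ HashesTo S x V y (F t) ω).card : ℝ)
      ≤ b / P + if t ∈ Q then b else 0 := by
    intro t ht
    by_cases htQ : t ∈ Q
    · rw [if_pos htQ]
      refine le_add_of_nonneg_of_le (by positivity) ?_
      exact Nat.cast_le.2 (Finset.card_le_card fun ω h => by
        simp only [Finset.mem_filter] at h ⊢; exact ⟨h.1, h.2.1⟩)
    · rw [if_neg htQ, add_zero, le_div_iff₀ hP0', hb]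
      have := card_hash_eq_mul_prod_le S x V y (F t)
        (fun ω => ∀ s ∈ L, HashesTo S x V y (F s) ω) ?_
      · have h' : _ * P ≤ _ := this
        convert (Nat.cast_le (α := ℝ)).2 h' using 1
        · push_cast; congr!
        · congr!
      · intro ω ω' hω hBω s hs v hv
        rw [← hω v (F s v) fun _ he => ?_]
        · exact hBω s hs v hv
        · exact htQ (Finset.mem_filter.2 ⟨ht, s, hs, v, hv, he.symm⟩)
  calc ∑ t ∈ T, ((Finset.univ.filter fun ω =>
        (∀ s ∈ L, HashesTo S x V y (F s) ω) ∧ HashesTo S x V y (F t) ω).card : ℝ)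
      ≤ ∑ t ∈ T, (b / P + if t ∈ Q then b else 0) := Finset.sum_le_sum hstep
    _ = T.card * (b / P) + Q.card * b := by
        rw [Finset.sum_add_distrib, Finset.sum_const, nsmul_eq_mul, ← Finset.sum_filter,
          Finset.sum_const, nsmul_eq_mul, Finset.filter_mem_eq_inter,
          Finset.inter_eq_right.2 (Finset.filter_subset _ _)]
    _ ≤ m * (b / P) + V.card * D * (m / P) * b := by gcongr
    _ = (m : ℝ) / P * (1 + V.card * D) * b := by ring

/-! ### Packings, the load bound, and the choice of the shares -/

theorem mem_residualAtoms {q : FullCQ k ℓ} {x : Finset (Fin k)} {j : Fin ℓ} :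
    j ∈ q.residualAtoms x ↔ (q.residualVars x j).Nonempty := by
  simp [residualAtoms]

theorem notMem_of_mem_residualVars {q : FullCQ k ℓ} {x : Finset (Fin k)} {j : Fin ℓ} {v : Fin k}
    (hv : v ∈ q.residualVars x j) : v ∉ x :=
  (Finset.mem_sdiff.1 hv).2

namespace IsResidualPacking

variable {q : FullCQ k ℓ} {x : Finset (Fin k)} {u : Fin ℓ → ℝ}

theorem le_one (hu : q.IsResidualPacking x u) (j : Fin ℓ) : u j ≤ 1 := by
  by_cases hj : j ∈ q.residualAtoms x
  · obtain ⟨v, hv⟩ := mem_residualAtoms.1 hj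
    refine le_trans ?_ (hu.2.2 v (notMem_of_mem_residualVars hv))
    exact Finset.single_le_sum (fun i _ => hu.1 i) (Finset.mem_filter.2 ⟨hj, hv⟩)
  · rw [hu.2.1 j hj]; exact zero_le_one

theorem sum_le (hu : q.IsResidualPacking x u) : ∑ j, u j ≤ ℓ := by
  simpa using Finset.sum_le_sum fun j (_ : j ∈ Finset.univ) => hu.le_one j

theorem sum_pos (hu : q.IsResidualPacking x u) (h0 : u ≠ 0) : 0 < ∑ j, u j := by
  obtain ⟨j, hj⟩ := Function.ne_iff.1 h0
  exact Finset.sum_pos' (fun i _ => hu.1 i) ⟨j, Finset.mem_univ j, (hu.1 j).lt_of_ne' hj⟩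

theorem sum_le_quasiPackingNumber (hu : q.IsResidualPacking x u) :
    ∑ j, u j ≤ q.quasiPackingNumber := by
  refine le_csSup ⟨ℓ, ?_⟩ ⟨x, u, hu, rfl⟩
  rintro _ ⟨x, u, hu, rfl⟩
  exact hu.sum_le

theorem packingLoad_le (hu : q.IsResidualPacking x u) (h0 : u ≠ 0) {M : Fin ℓ → ℝ} {B : ℝ}
    (hM : ∀ j, 0 ≤ M j) (hB : ∀ j, M j ≤ B) (hB0 : 0 ≤ B) (p : ℕ) :
    packingLoad u M p ≤ B / (p : ℝ) ^ (1 / ∑ j, u j) := by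
  have hs := hu.sum_pos h0
  have h1 : ∏ j, M j ^ u j ≤ B ^ ∑ j, u j := by
    rw [Real.rpow_sum_of_nonneg hB0 fun i _ => hu.1 i]
    exact Finset.prod_le_prod (fun j _ => Real.rpow_nonneg (hM j) _)
      fun j _ => Real.rpow_le_rpow (hM j) (hB j) (hu.1 j)
  have h2 : 0 ≤ ∏ j, M j ^ u j := Finset.prod_nonneg fun j _ => Real.rpow_nonneg (hM j) _
  calc packingLoad u M p ≤ (B ^ (∑ j, u j) / (p : ℝ)) ^ (1 / ∑ j, u j) := by
        unfold packingLoad; gcongr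
    _ = B / (p : ℝ) ^ (1 / ∑ j, u j) := by
        rw [Real.div_rpow (Real.rpow_nonneg hB0 _) (Nat.cast_nonneg p), one_div,
          Real.rpow_rpow_inv hB0 hs.ne']

end IsResidualPacking

theorem packingLoad_nonneg (u : Fin ℓ → ℝ) {M : Fin ℓ → ℝ} (hM : ∀ j, 0 ≤ M j) (p : ℕ) :
    0 ≤ packingLoad u M p :=
  Real.rpow_nonneg (div_nonneg (Finset.prod_nonneg fun j _ => Real.rpow_nonneg (hM j) _)
    (Nat.cast_nonneg p)) _

theorem packingLoad_pos {u M : Fin ℓ → ℝ} (h : ∀ j, 0 < M j ∨ u j = 0) {p : ℕ} (hp : 0 < p) :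
    0 < packingLoad u M p := by
  refine Real.rpow_pos_of_pos (div_pos (Finset.prod_pos fun j _ => ?_) (by exact_mod_cast hp)) _
  rcases h j with h | h
  · exact Real.rpow_pos_of_pos h _
  · simp [h]

theorem residualLoad_nonneg (q : FullCQ k ℓ) (x : Finset (Fin k)) {M : Fin ℓ → ℝ}
    (hM : ∀ j, 0 ≤ M j) (p : ℕ) : 0 ≤ q.residualLoad x M p := by
  refine Real.sSup_nonneg ?_
  rintro _ ⟨u, _, _, rfl⟩
  exact packingLoad_nonneg u hM p

theorem packingLoad_le_residualLoad {q : FullCQ k ℓ} {x : Finset (Fin k)} {u : Fin ℓ → ℝ}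
    (hu : q.IsResidualPacking x u) (h0 : u ≠ 0) {M : Fin ℓ → ℝ} (hM : ∀ j, 0 ≤ M j) {p : ℕ}
    (hp : 0 < p) : packingLoad u M p ≤ q.residualLoad x M p := by
  refine le_csSup ⟨∑ j, M j, ?_⟩ ⟨u, hu, h0, rfl⟩
  rintro _ ⟨u, hu, h0, rfl⟩
  have hp1 : (1 : ℝ) ≤ p := by exact_mod_cast hp
  have hs : 0 ≤ ∑ j, M j := Finset.sum_nonneg fun j _ => hM j
  refine (hu.packingLoad_le h0 hM
    (fun j => Finset.single_le_sum (fun i _ => hM i) (Finset.mem_univ j)) hs p).trans ?_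
  exact div_le_self hs (Real.one_le_rpow hp1 (one_div_nonneg.2 (hu.sum_pos h0).le))

theorem residualLoad_le_maxResidualLoad (q : FullCQ k ℓ) (x : Finset (Fin k)) (M : Fin ℓ → ℝ)
    (p : ℕ) : q.residualLoad x M p ≤ q.maxResidualLoad M p :=
  le_ciSup (f := fun x => q.residualLoad x M p) (Set.finite_range _).bddAbove x

theorem maxResidualLoad_nonneg (q : FullCQ k ℓ) {M : Fin ℓ → ℝ} (hM : ∀ j, 0 ≤ M j) (p : ℕ) :
    0 ≤ q.maxResidualLoad M p :=
  (q.residualLoad_nonneg ∅ hM p).trans (q.residualLoad_le_maxResidualLoad ∅ M p)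

theorem maxResidualLoad_le_of_le (q : FullCQ k ℓ) {M : Fin ℓ → ℝ} {B : ℝ} (hM : ∀ j, 0 ≤ M j)
    (hB : ∀ j, M j ≤ B) (hB0 : 0 ≤ B) {p : ℕ} (hp : 0 < p) :
    q.maxResidualLoad M p ≤ B / (p : ℝ) ^ (1 / q.quasiPackingNumber) := by
  have hp1 : (1 : ℝ) ≤ p := by exact_mod_cast hp
  refine ciSup_le fun x => Real.sSup_le ?_ (by positivity)
  rintro _ ⟨u, hu, h0, rfl⟩
  refine (hu.packingLoad_le h0 hM hB hB0 p).trans ?_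
  refine div_le_div_of_nonneg_left hB0 (by positivity) (Real.rpow_le_rpow_of_exponent_le hp1 ?_)
  exact one_div_le_one_div_of_le (hu.sum_pos h0) hu.sum_le_quasiPackingNumber

/-- Half of linear programming duality: if the exponents `f` did not exist, a hyperplane would
separate the vectors `(log M_j - ∑ v, f v)_j` from the orthant below `log (2 L)`, and its normal
vector, rescaled, would be a packing whose load exceeds `L`. The factor `2` makes the orthant open,
which spares a compactness argument. -/
theorem exists_share_exponents (q : FullCQ k ℓ) (x : Finset (Fin k)) {M : Fin ℓ → ℝ}
    (hM : ∀ j, 0 ≤ M j) {p : ℕ} (hp : 0 < p) :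
    ∃ f : Fin k → ℝ, (∀ v, 0 ≤ f v) ∧ (∀ v ∈ x, f v = 0) ∧ ∑ v, f v ≤ Real.log p ∧
      ∀ j ∈ q.residualAtoms x,
        M j ≤ 2 * q.residualLoad x M p * Real.exp (∑ v ∈ q.residualVars x j, f v) := by
  classical
  have hp1 : (1 : ℝ) ≤ p := by exact_mod_cast hp
  have hlog : 0 ≤ Real.log p := Real.log_nonneg hp1
  have hL0 := q.residualLoad_nonneg x hM p
  set Lx := q.residualLoad x M p with hLx
  set J := (q.residualAtoms x).filter fun j => 0 < M j with hJ
  -- The packing that consists of a single atom shows that the load bound is positive.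
  have hLpos : ∀ j ∈ J, 0 < Lx := by
    intro j hj
    obtain ⟨hj, hMj⟩ := Finset.mem_filter.1 hj
    have hpack : q.IsResidualPacking x (Pi.single j 1) := by
      have h0 : ∀ i, (0 : ℝ) ≤ (Pi.single j 1 : Fin ℓ → ℝ) i :=
        (Pi.single_nonneg.2 zero_le_one : (0 : Fin ℓ → ℝ) ≤ Pi.single j 1)
      refine ⟨h0, fun i hi => Pi.single_eq_of_ne (ne_of_mem_of_not_mem hj hi).symm _, fun v _ => ?_⟩
      refine (Finset.sum_le_sum_of_subset_of_nonneg (Finset.subset_univ _)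
        fun i _ _ => h0 i).trans ?_
      simp
    refine lt_of_lt_of_le (packingLoad_pos (fun i => ?_) hp)
      (packingLoad_le_residualLoad hpack (by simp) hM hp)
    by_cases hij : i = j
    · subst hij; exact Or.inl hMj
    · exact Or.inr (Pi.single_eq_of_ne hij _)
  by_contra hcon
  -- `K` consists of the attainable vectors; only the coordinates in `J` matter for `Q`.
  set K : Set (Fin ℓ → ℝ) := {z | ∃ f : Fin k → ℝ, (∀ v, 0 ≤ f v) ∧ (∀ v ∈ x, f v = 0) ∧
    ∑ v, f v ≤ Real.log p ∧ ∀ j, z j = Real.log (M j) - ∑ v ∈ q.residualVars x j, f v} with hK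
  set c₀ := Real.log (2 * Lx) with hc₀
  set Q : Set (Fin ℓ → ℝ) := Set.pi (J : Set (Fin ℓ)) fun _ => Set.Iio c₀ with hQ
  have hQo : IsOpen Q := isOpen_set_pi J.finite_toSet fun _ _ => isOpen_Iio
  have hQc : Convex ℝ Q := convex_pi fun _ _ => convex_Iio c₀
  have hKc : Convex ℝ K := by
    rintro z ⟨f, hf0, hfx, hfs, hz⟩ w ⟨g, hg0, hgx, hgs, hw⟩ a b ha hb hab
    refine ⟨fun v => a * f v + b * g v,
      fun v => add_nonneg (mul_nonneg ha (hf0 v)) (mul_nonneg hb (hg0 v)),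
      fun v hv => by simp [hfx v hv, hgx v hv], ?_, fun j => ?_⟩
    · rw [Finset.sum_add_distrib, ← Finset.mul_sum, ← Finset.mul_sum]
      calc _ ≤ a * Real.log p + b * Real.log p := by gcongr
        _ = Real.log p := by rw [← add_mul, hab, one_mul]
    · simp only [Pi.add_apply, Pi.smul_apply, smul_eq_mul, hz, hw]
      rw [Finset.sum_add_distrib, ← Finset.mul_sum, ← Finset.mul_sum]
      linear_combination Real.log (M j) * hab
  have hdisj : Disjoint Q K := by
    rw [Set.disjoint_left]
    rintro z hzQ ⟨f, hf0, hfx, hfs, hz⟩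
    refine hcon ⟨f, hf0, hfx, hfs, fun j hj => ?_⟩
    rcases (hM j).eq_or_lt with h0 | h0
    · rw [← h0]; positivity
    have hjJ : j ∈ J := Finset.mem_filter.2 ⟨hj, h0⟩
    have h1 : z j < c₀ := hzQ j (Finset.mem_coe.2 hjJ)
    have h2 : 0 < 2 * Lx := mul_pos two_pos (hLpos j hjJ)
    rw [hz, hc₀] at h1
    rw [← Real.log_le_log_iff h0 (mul_pos h2 (Real.exp_pos _)),
      Real.log_mul h2.ne' (Real.exp_pos _).ne', Real.log_exp]
    linarith
  obtain ⟨φ, c, hφQ, hφK⟩ := geometric_hahn_banach_open hQc hQo hKc hdisj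
  set u : Fin ℓ → ℝ := fun j => φ (Pi.single j 1) with hu
  have hφ : ∀ z, φ z = ∑ j, z j * u j := by
    intro z
    have h1 : z = ∑ j, z j • (Pi.single j 1 : Fin ℓ → ℝ) := by
      ext i; simp [Finset.sum_apply, Pi.single_apply]
    conv_lhs => rw [h1]
    simp [map_sum, hu]
  -- Moving from a point of `Q` along a coordinate, downwards or outside `J`, stays in `Q`.
  have hmove : ∀ j s, (j ∈ J → 0 ≤ s) → (c₀ - 1) * ∑ i, u i - s * u j < c := by
    intro j s hs
    have h1 := hφQ (fun i => c₀ - 1 - s * (Pi.single j 1 : Fin ℓ → ℝ) i) ?_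
    · rw [hφ] at h1
      simpa [sub_mul, Finset.sum_sub_distrib, ← Finset.mul_sum, Pi.single_apply] using h1
    · intro i hi
      rw [Set.mem_Iio]
      by_cases hij : i = j
      · subst hij
        have := hs hi
        simp only [Pi.single_eq_same]
        linarith
      · simp [Pi.single_eq_of_ne hij]
  have hu0 : ∀ j, 0 ≤ u j := by
    intro j
    by_contra! hneg
    set d := c - (c₀ - 1) * ∑ i, u i with hd
    have h1 := hmove j (|d| / (-u j)) fun _ => div_nonneg (abs_nonneg d) (by linarith)
    have h2 : |d| / (-u j) * u j = -|d| := by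
      rw [div_neg, neg_mul, div_mul_cancel₀ _ hneg.ne]
    have := le_abs_self d
    linarith
  have huJ : ∀ j, j ∉ J → u j = 0 := by
    intro j hj
    by_contra hne
    set d := c - (c₀ - 1) * ∑ i, u i with hd
    have h1 := hmove j (-d / u j) fun h => absurd h hj
    rw [div_mul_cancel₀ _ hne] at h1
    linarith
  -- The exponents that put all of `log p` on a single variable `v`.
  have hdual : ∀ v, v ∉ x → c ≤ ∑ j, Real.log (M j) * u j -
      Real.log p * ∑ j, if v ∈ q.residualVars x j then u j else 0 := by
    intro v hv
    have h1 := hφK (fun j => Real.log (M j) - if v ∈ q.residualVars x j then Real.log p else 0)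
      ⟨Pi.single v (Real.log p), fun w => ?_, fun w hw => ?_, ?_, fun j => ?_⟩
    · rw [hφ] at h1
      refine h1.trans (le_of_eq ?_)
      simp only [sub_mul, Finset.sum_sub_distrib, Finset.mul_sum, ite_mul, zero_mul, mul_ite,
        mul_zero]
    · exact (Pi.single_nonneg.2 hlog : (0 : Fin k → ℝ) ≤ Pi.single v (Real.log p)) w
    · exact Pi.single_eq_of_ne (ne_of_mem_of_not_mem hw hv) _
    · simp
    · simp [Pi.single_apply]
  have hune : ∃ j, u j ≠ 0 := by
    by_contra! h0
    have h1 := hφQ (fun _ => c₀ - 1) fun i _ => by simp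
    have h2 := hφK (fun j => Real.log (M j)) ⟨0, by simp, by simp, by simpa using hlog, by simp⟩
    simp only [hφ, h0, mul_zero, Finset.sum_const_zero] at h1 h2
    linarith
  obtain ⟨j₀, hj₀⟩ := hune
  have hj₀J : j₀ ∈ J := by_contra fun h => hj₀ (huJ j₀ h)
  have hpos₀ : 0 < u j₀ := (hu0 j₀).lt_of_ne' hj₀
  obtain ⟨v₀, hv₀⟩ := mem_residualAtoms.1 (Finset.mem_filter.1 hj₀J).1
  set load : Fin k → ℝ := fun v => ∑ j, if v ∈ q.residualVars x j then u j else 0 with hload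
  obtain ⟨v₁, hv₁, hmax⟩ := Finset.exists_max_image (Finset.univ \ x) load
    ⟨v₀, by simpa using notMem_of_mem_residualVars hv₀⟩
  have hα : 0 < load v₁ := by
    refine lt_of_lt_of_le ?_ (hmax v₀ (by simpa using notMem_of_mem_residualVars hv₀))
    refine lt_of_lt_of_le hpos₀ ?_
    refine le_trans (by rw [if_pos hv₀]) (Finset.single_le_sum
      (f := fun j => if v₀ ∈ q.residualVars x j then u j else 0) (fun i _ => ?_)
      (Finset.mem_univ j₀))
    split_ifs
    exacts [hu0 i, le_rfl]
  have hdual₁ := hdual v₁ (by simpa using hv₁)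
  set α := load v₁ with hαdef
  have hs : 0 < ∑ j, u j := Finset.sum_pos' (fun i _ => hu0 i) ⟨j₀, Finset.mem_univ _, hpos₀⟩
  -- The normalized weights `u / α` form a packing, as `α` is the largest total weight at a variable.
  have hpack : q.IsResidualPacking x fun j => u j / α := by
    refine ⟨fun j => div_nonneg (hu0 j) hα.le, fun j hj => ?_, fun v hv => ?_⟩
    · simp [huJ j fun h => hj (Finset.mem_filter.1 h).1]
    · rw [← Finset.sum_div, div_le_one hα]
      refine le_trans ?_ (hmax v (by simpa using hv))
      simp only [hload]
      rw [← Finset.sum_filter]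
      exact Finset.sum_le_sum_of_subset_of_nonneg
        (Finset.filter_subset_filter _ (Finset.subset_univ _)) fun i _ _ => hu0 i
  have hle := packingLoad_le_residualLoad hpack
    (Function.ne_iff.2 ⟨j₀, (div_pos hpos₀ hα).ne'⟩) hM hp
  have hLx0 : 0 < Lx := hLpos j₀ hj₀J
  have hpl : Real.log (packingLoad (fun j => u j / α) M p) =
      (∑ j, Real.log (M j) * u j - Real.log p * α) / ∑ j, u j := by
    have hne : ∀ j, M j ^ (u j / α) ≠ 0 := by
      intro j
      by_cases hj : j ∈ J
      · exact (Real.rpow_pos_of_pos (Finset.mem_filter.1 hj).2 _).ne'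
      · simp [huJ j hj]
    have hprod : Real.log (∏ j, M j ^ (u j / α)) = (∑ j, Real.log (M j) * u j) / α := by
      rw [Real.log_prod fun j _ => hne j, Finset.sum_div]
      refine Finset.sum_congr rfl fun j _ => ?_
      by_cases hj : j ∈ J
      · rw [Real.log_rpow (Finset.mem_filter.1 hj).2]; ring
      · simp [huJ j hj]
    have hppos : 0 < ∏ j, M j ^ (u j / α) :=
      (Finset.prod_nonneg fun j _ => Real.rpow_nonneg (hM j) _).lt_of_ne'
        (Finset.prod_ne_zero_iff.2 fun j _ => hne j)
    rw [packingLoad, Real.log_rpow (div_pos hppos (by positivity)),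
      Real.log_div hppos.ne' (by positivity), hprod, ← Finset.sum_div]
    field_simp
  have hlogle : Real.log (packingLoad (fun j => u j / α) M p) ≤ Real.log Lx := by
    refine Real.log_le_log (packingLoad_pos (fun j => ?_) hp) hle
    by_cases hj : j ∈ J
    · exact Or.inl (Finset.mem_filter.1 hj).2
    · exact Or.inr (by rw [huJ j hj, zero_div])
  have hcc : c₀ * ∑ j, u j ≤ c := by
    refine le_of_forall_pos_lt_add fun ε hε => ?_
    have h1 := hφQ (fun _ => c₀ - ε / ∑ j, u j) fun i _ => by
      simpa using div_pos hε hs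
    rw [hφ, ← Finset.mul_sum, sub_mul, div_mul_cancel₀ _ hs.ne'] at h1
    linarith
  rw [hpl, div_le_iff₀ hs] at hlogle
  have h2 : c₀ * ∑ j, u j ≤ Real.log Lx * ∑ j, u j := by linarith
  have h3 := le_of_mul_le_mul_right h2 hs
  rw [hc₀, Real.log_mul two_ne_zero hLx0.ne'] at h3
  have := Real.log_pos one_lt_two
  linarith

/-- Rounding the shares `exp (f v)` down to integers costs a factor of at most `2` for each
variable. -/
theorem exists_hyperCubeFamily (q : FullCQ k ℓ) {M : Fin ℓ → ℝ} (hM : ∀ j, 0 ≤ M j) {p : ℕ}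
    (hp : 0 < p) :
    ∃ S : HyperCubeFamily k p, ∀ x, ∀ j ∈ q.residualAtoms x,
      M j ≤ 2 ^ (k + 1) * q.residualLoad x M p *
        ((∏ v ∈ q.residualVars x j, S.share x v : ℕ) : ℝ) := by
  choose f hf0 hfx hfs hfM using fun x => q.exists_share_exponents x hM hp
  have hp' : (0 : ℝ) < p := by exact_mod_cast hp
  have hone : ∀ x v, 1 ≤ Real.exp (f x v) := fun x v => Real.one_le_exp (hf0 x v)
  have hpos : ∀ x v, 0 < ⌊Real.exp (f x v)⌋₊ := fun x v => Nat.floor_pos.2 (hone x v)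
  have hprod : ∀ x, ∏ v, ⌊Real.exp (f x v)⌋₊ ≤ p := by
    intro x
    have : ((∏ v, ⌊Real.exp (f x v)⌋₊ : ℕ) : ℝ) ≤ p := by
      push_cast
      calc ∏ v, (⌊Real.exp (f x v)⌋₊ : ℝ) ≤ ∏ v, Real.exp (f x v) :=
            Finset.prod_le_prod (fun _ _ => Nat.cast_nonneg _)
              fun v _ => Nat.floor_le (Real.exp_pos _).le
        _ = Real.exp (∑ v, f x v) := (Real.exp_sum _ _).symm
        _ ≤ p := (Real.le_log_iff_exp_le hp').1 (hfs x)
    exact_mod_cast this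
  have hemb : ∀ x, Nonempty ((∀ v, Fin ⌊Real.exp (f x v)⌋₊) ↪ Fin p) := fun x =>
    Function.Embedding.nonempty_of_card_le (by simpa [Fintype.card_pi] using hprod x)
  refine ⟨⟨fun x v => ⌊Real.exp (f x v)⌋₊, hpos, fun x v hv => by simp [hfx x v hv],
    fun x => (hemb x).some⟩, fun x j hj => (hfM x j hj).trans ?_⟩
  have h1 : Real.exp (∑ v ∈ q.residualVars x j, f x v) ≤
      2 ^ k * ((∏ v ∈ q.residualVars x j, ⌊Real.exp (f x v)⌋₊ : ℕ) : ℝ) := by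
    rw [Real.exp_sum]
    calc ∏ v ∈ q.residualVars x j, Real.exp (f x v)
        ≤ ∏ v ∈ q.residualVars x j, 2 * (⌊Real.exp (f x v)⌋₊ : ℝ) := by
          refine Finset.prod_le_prod (fun _ _ => (Real.exp_pos _).le) fun v _ => ?_
          have h2 := Nat.lt_floor_add_one (Real.exp (f x v))
          have h3 : (1 : ℝ) ≤ ⌊Real.exp (f x v)⌋₊ := by exact_mod_cast hpos x v
          linarith
      _ = 2 ^ (q.residualVars x j).card *
            ((∏ v ∈ q.residualVars x j, ⌊Real.exp (f x v)⌋₊ : ℕ) : ℝ) := by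
          rw [Finset.prod_mul_distrib, Finset.prod_const]; push_cast; rfl
      _ ≤ _ := by
          gcongr
          · norm_num
          · simpa using Finset.card_le_univ (q.residualVars x j)
  calc _ ≤ 2 * q.residualLoad x M p *
        (2 ^ k * ((∏ v ∈ q.residualVars x j, ⌊Real.exp (f x v)⌋₊ : ℕ) : ℝ)) :=
      mul_le_mul_of_nonneg_left h1 (mul_nonneg zero_le_two (q.residualLoad_nonneg x hM p))
    _ = _ := by ring

/-! ### Correctness of the algorithm -/

theorem mem_answer {q : FullCQ k ℓ} {n : ℕ} {I : q.Database n} {t : Fin k → Fin n} :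
    t ∈ q.answer I ↔ ∀ j, (fun r => t (q.atom j r)) ∈ I j := by
  simp [answer]

open Classical in
/-- An answer `t` is found at the server that represents its hash values in the instance of the set
of variables at which `t` is heavy. -/
theorem hyperCube_result (q : FullCQ k ℓ) {n p : ℕ} (S : HyperCubeFamily k p) (I : q.Database n)
    (owner : q.Placement n p) (ω : HashFamily S n) :
    (q.hyperCube n S).result I owner ω = q.answer I := by
  have hrec : ∀ (s' : Fin p) (j : Fin ℓ) (t : q.Tuple n j),
      t ∈ (Finset.univ.biUnion fun s => q.decode ((q.hyperCube n S).message I owner ω s s') j) ↔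
        t ∈ I j ∧ q.SentTo S ω (q.heavyHitters p I) j t s' := by
    intro s' j t
    simp only [OneRoundAlgorithm.message, hyperCube, decode_encode, fragment, Finset.mem_biUnion,
      Finset.mem_univ, true_and, Finset.mem_filter]
    constructor
    · rintro ⟨s, ⟨h1, -⟩, h2⟩; exact ⟨h1, h2⟩
    · rintro ⟨h1, h2⟩; exact ⟨_, ⟨h1, rfl⟩, h2⟩
  have hout : ∀ (s' : Fin p) (t : Fin k → Fin n),
      t ∈ (q.hyperCube n S).output ω (q.heavyHitters p I) s' (q.fragment I owner s')
        (fun s => (q.hyperCube n S).message I owner ω s s') ↔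
      ∀ j, (fun r => t (q.atom j r)) ∈ I j ∧
        q.SentTo S ω (q.heavyHitters p I) j (fun r => t (q.atom j r)) s' := fun s' t =>
    mem_answer.trans (forall_congr' fun j => hrec s' j _)
  ext t
  refine Finset.mem_biUnion.trans ?_
  rw [mem_answer]
  constructor
  · rintro ⟨s', -, h⟩ j
    exact ((hout s' t).1 h j).1
  · intro h
    set x := Finset.univ.filter fun v => q.HeavyAt (q.heavyHitters p I) v (t v) with hx
    refine ⟨S.server x fun v => ω x v (t v), Finset.mem_univ _, (hout _ t).2 fun j => ⟨h j, ?_⟩⟩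
    exact ⟨x, fun r => by simp [hx], _, rfl, fun r => rfl⟩

/-! ### The load of a server -/

theorem length_encodeTuple (q : FullCQ k ℓ) {n : ℕ} (f : Σ j, q.Tuple n j) :
    (q.encodeTuple f).length = f.1 + 1 + q.arity f.1 * Nat.clog 2 n := by
  simp [encodeTuple, encodeValue, List.length_flatten, List.map_ofFn, Function.comp_def]
  ring

theorem length_encode (q : FullCQ k ℓ) {n : ℕ} (F : q.Database n) :
    (q.encode F).length = ∑ j, (F j).card * (j + 1 + q.arity j * Nat.clog 2 n) := by
  rw [encode, List.length_flatten, List.map_map, Finset.sum_map_toList, Finset.sum_sigma]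
  simp [length_encodeTuple]

open Classical in
theorem sum_length_message (q : FullCQ k ℓ) {n p : ℕ} (S : HyperCubeFamily k p) (I : q.Database n)
    (owner : q.Placement n p) (ω : HashFamily S n) (s' : Fin p) :
    ∑ s, ((q.hyperCube n S).message I owner ω s s').length =
      ∑ j, ((I j).filter fun t => q.SentTo S ω (q.heavyHitters p I) j t s').card *
        (j + 1 + q.arity j * Nat.clog 2 n) := by
  simp only [OneRoundAlgorithm.message, hyperCube, length_encode, fragment]
  rw [Finset.sum_comm]
  refine Finset.sum_congr rfl fun j _ => ?_
  rw [← Finset.sum_mul]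
  congr 1
  rw [Finset.card_eq_sum_card_fiberwise (f := owner j) (t := Finset.univ) fun _ _ => by simp]
  refine Finset.sum_congr rfl fun s _ => ?_
  rw [Finset.filter_comm]

open Classical in
/-- The tuples of `S_j` that the HyperCube instance of `x` handles. -/
noncomputable def patternTuples (q : FullCQ k ℓ) {n : ℕ} (p : ℕ) (I : q.Database n)
    (x : Finset (Fin k)) (j : Fin ℓ) : Finset (q.Tuple n j) :=
  (I j).filter fun t => ∀ r, q.HeavyAt (q.heavyHitters p I) (q.atom j r) (t r) ↔ q.atom j r ∈ x

open Classical in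
/-- A position at which the variable `v` occurs in `S_j`; position `0` if `v` does not occur. -/
noncomputable def position (q : FullCQ k ℓ) (j : Fin ℓ) (v : Fin k) : Fin (q.arity j) :=
  if h : ∃ r, q.atom j r = v then h.choose else ⟨0, q.arity_pos j⟩

theorem atom_position {q : FullCQ k ℓ} {j : Fin ℓ} {v : Fin k} (hv : v ∈ q.vars j) :
    q.atom j (q.position j v) = v := by
  have h : ∃ r, q.atom j r = v := by simpa [vars] using hv
  rw [position, dif_pos h]
  exact h.choose_spec

/-- The value of the tuple `t` of `S_j` at the variable `v` of `S_j`. If `v` occurs repeatedly, one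
position is chosen; the hash value at this position alone already bounds where `t` is sent. -/
noncomputable def valueAt (q : FullCQ k ℓ) {n : ℕ} (j : Fin ℓ) (t : q.Tuple n j) (v : Fin k) :
    Fin n :=
  t (q.position j v)

open Classical in
/-- The instance of `x` handles only tuples whose values at the variables outside of `x` are light. -/
theorem mul_card_filter_valueAt_le (q : FullCQ k ℓ) {n p : ℕ} (I : q.Database n)
    (x : Finset (Fin k)) (j : Fin ℓ) {t : q.Tuple n j} (ht : t ∈ q.patternTuples p I x j) {v : Fin k}
    (hv : v ∈ q.residualVars x j) :
    p * ((q.patternTuples p I x j).filter fun t' => q.valueAt j t' v = q.valueAt j t v).card ≤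
      (I j).card := by
  obtain ⟨htI, hpat⟩ := Finset.mem_filter.1 ht
  obtain ⟨hvj, hvx⟩ := Finset.mem_sdiff.1 hv
  have h1 := hpat (q.position j v)
  rw [atom_position hvj] at h1
  have h2 : t (q.position j v) ∉ q.heavyHitters p I j (q.position j v) := fun h =>
    hvx (h1.1 ⟨j, _, atom_position hvj, h⟩)
  simp only [heavyHitters, Finset.mem_filter, Finset.mem_univ, true_and, not_and, not_le] at h2
  refine le_trans (Nat.mul_le_mul_left p (Finset.card_le_card ?_))
    (h2 (Finset.card_pos.2 ⟨t, Finset.mem_filter.2 ⟨htI, rfl⟩⟩)).le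
  intro t' ht'
  obtain ⟨h3, h4⟩ := Finset.mem_filter.1 ht'
  exact Finset.mem_filter.2 ⟨(Finset.mem_filter.1 h3).1, h4⟩

theorem card_heavyHitters_le (q : FullCQ k ℓ) {n : ℕ} (p : ℕ) (I : q.Database n) (j : Fin ℓ)
    (r : Fin (q.arity j)) : (q.heavyHitters p I j r).card ≤ p := by
  rcases Nat.eq_zero_or_pos (I j).card with h0 | h0
  · simp [heavyHitters, Finset.card_eq_zero.1 h0]
  refine Nat.le_of_mul_le_mul_right ?_ h0
  calc (q.heavyHitters p I j r).card * (I j).card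
      ≤ ∑ h ∈ q.heavyHitters p I j r, p * ((I j).filter fun t => t r = h).card := by
        rw [← smul_eq_mul]
        exact Finset.card_nsmul_le_sum _ _ _ fun h hh => (Finset.mem_filter.1 hh).2.2
    _ ≤ ∑ h, p * ((I j).filter fun t => t r = h).card :=
        Finset.sum_le_sum_of_subset (Finset.subset_univ _)
    _ = p * (I j).card := by
        rw [← Finset.mul_sum, Finset.card_eq_sum_card_fiberwise (f := fun t => t r)
          (t := Finset.univ) (fun _ _ => by simp)]

/-- There are few heavy values, hence few tuples all of whose values are heavy. -/
theorem card_patternTuples_le_of_residualVars_eq_empty (q : FullCQ k ℓ) {n : ℕ} (p : ℕ)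
    (I : q.Database n) {x : Finset (Fin k)} {j : Fin ℓ} (hx : q.residualVars x j = ∅) :
    (q.patternTuples p I x j).card ≤ ((∑ i, q.arity i) * p) ^ q.arity j := by
  classical
  set H := Finset.univ.biUnion fun i => Finset.univ.biUnion fun r => q.heavyHitters p I i r with hH
  have hcard : H.card ≤ (∑ i, q.arity i) * p := by
    rw [Finset.sum_mul]
    refine Finset.card_biUnion_le.trans (Finset.sum_le_sum fun i _ => ?_)
    refine Finset.card_biUnion_le.trans ?_
    simpa using Finset.sum_le_sum fun r (_ : r ∈ Finset.univ) => q.card_heavyHitters_le p I i r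
  have hsub : q.patternTuples p I x j ⊆ Fintype.piFinset fun _ => H := by
    intro t ht
    refine Fintype.mem_piFinset.2 fun r => ?_
    have hr : q.atom j r ∈ x := by
      by_contra h
      have : q.atom j r ∈ q.residualVars x j :=
        Finset.mem_sdiff.2 ⟨Finset.mem_image_of_mem _ (Finset.mem_univ r), h⟩
      simp [hx] at this
    obtain ⟨i, r', -, h⟩ := ((Finset.mem_filter.1 ht).2 r).2 hr
    simp only [hH, Finset.mem_biUnion, Finset.mem_univ, true_and]
    exact ⟨i, r', h⟩
  refine (Finset.card_le_card hsub).trans ?_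
  rw [Fintype.card_piFinset, Finset.prod_const, Finset.card_univ, Fintype.card_fin]
  exact Nat.pow_le_pow_left hcard _

open Classical in
/-- A server is at most one point of each hypercube, so bounds `b x` for the points of the hypercubes
add up to a bound for the server. -/
theorem card_sentTo_le_sum (q : FullCQ k ℓ) {n p : ℕ} (S : HyperCubeFamily k p) (I : q.Database n)
    (ω : HashFamily S n) (j : Fin ℓ) (s' : Fin p) {b : Finset (Fin k) → ℝ} (hb0 : ∀ x, 0 ≤ b x)
    (hb : ∀ x y, (((q.patternTuples p I x j).filter fun t =>
      HashesTo S x (q.residualVars x j) y (q.valueAt j t) ω).card : ℝ) ≤ b x) :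
    (((I j).filter fun t => q.SentTo S ω (q.heavyHitters p I) j t s').card : ℝ) ≤ ∑ x, b x := by
  have hsub : ((I j).filter fun t => q.SentTo S ω (q.heavyHitters p I) j t s') ⊆
      Finset.univ.biUnion fun x => (q.patternTuples p I x j).filter fun t =>
        ∃ y, S.server x y = s' ∧ HashesTo S x (q.residualVars x j) y (q.valueAt j t) ω := by
    intro t ht
    obtain ⟨htI, x, hpat, y, hy, hash⟩ := Finset.mem_filter.1 ht
    refine Finset.mem_biUnion.2 ⟨x, Finset.mem_univ x,
      Finset.mem_filter.2 ⟨Finset.mem_filter.2 ⟨htI, hpat⟩, y, hy, fun v hv => ?_⟩⟩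
    have key : ∀ w, q.atom j (q.position j v) = w → ω x w (t (q.position j v)) = y w := by
      rintro _ rfl; exact hash _
    exact key v (atom_position (Finset.mem_sdiff.1 hv).1)
  have hcard : ∀ x, (((q.patternTuples p I x j).filter fun t =>
      ∃ y, S.server x y = s' ∧ HashesTo S x (q.residualVars x j) y (q.valueAt j t) ω).card : ℝ) ≤
      b x := by
    intro x
    by_cases h : ∃ y, S.server x y = s'
    · obtain ⟨y, hy⟩ := h
      refine le_trans (Nat.cast_le.2 (Finset.card_le_card fun t ht => ?_)) (hb x y)
      obtain ⟨ht, y', hy', hash⟩ := Finset.mem_filter.1 ht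
      obtain rfl := (S.server x).injective (hy'.trans hy.symm)
      exact Finset.mem_filter.2 ⟨ht, hash⟩
    · rw [Finset.filter_eq_empty_iff.2 fun t _ ⟨y, hy, _⟩ => h ⟨y, hy⟩]
      simpa using hb0 x
  calc _ ≤ ((Finset.univ.biUnion fun x => (q.patternTuples p I x j).filter fun t =>
        ∃ y, S.server x y = s' ∧
          HashesTo S x (q.residualVars x j) y (q.valueAt j t) ω).card : ℝ) :=
        Nat.cast_le.2 (Finset.card_le_card hsub)
    _ ≤ ∑ x, (((q.patternTuples p I x j).filter fun t => ∃ y, S.server x y = s' ∧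
          HashesTo S x (q.residualVars x j) y (q.valueAt j t) ω).card : ℝ) := by
        exact_mod_cast Finset.card_biUnion_le
    _ ≤ ∑ x, b x := Finset.sum_le_sum fun x _ => hcard x

theorem prod_share_le {p : ℕ} (S : HyperCubeFamily k p) (x V : Finset (Fin k)) :
    ∏ v ∈ V, S.share x v ≤ p := by
  refine (Finset.prod_le_prod_of_subset_of_one_le' (Finset.subset_univ V)
    fun v _ _ => S.share_pos x v).trans ?_
  simpa [Fintype.card_pi] using Fintype.card_le_of_embedding (S.server x)

open Classical in
/-- In the instance of some `x`, some point of the hypercube receives more than `e (1 + |V| D)` times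
its fair share of the tuples of some relation `S_j`, where `V` is the set of variables of `S_j` outside
of `x`. -/
def Overloaded (q : FullCQ k ℓ) {n p : ℕ} (S : HyperCubeFamily k p) (I : q.Database n) (D : ℕ)
    (ω : HashFamily S n) : Prop :=
  ∃ x j y, Real.exp 1 * (((I j).card : ℝ) / ((∏ v ∈ q.residualVars x j, S.share x v : ℕ) : ℝ) *
      (1 + (q.residualVars x j).card * D)) <
    (((q.patternTuples p I x j).filter fun t =>
      HashesTo S x (q.residualVars x j) y (q.valueAt j t) ω).card : ℝ)

open Classical in
/-- The union bound over the sets `x`, the atoms, and the at most `p` points of each hypercube. -/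
theorem card_overloaded_le (q : FullCQ k ℓ) {n p : ℕ} (hp : 0 < p) (S : HyperCubeFamily k p)
    (I : q.Database n) (D : ℕ) :
    ((Finset.univ.filter fun ω : HashFamily S n => q.Overloaded S I D ω).card : ℝ) ≤
      2 ^ k * ℓ * p * Real.exp (-(D : ℝ)) * Fintype.card (HashFamily S n) := by
  set bad : ∀ x, Fin ℓ → (∀ v, Fin (S.share x v)) → Finset (HashFamily S n) := fun x j y =>
    Finset.univ.filter fun ω : HashFamily S n =>
      Real.exp 1 * (((I j).card : ℝ) / ((∏ v ∈ q.residualVars x j, S.share x v : ℕ) : ℝ) *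
        (1 + (q.residualVars x j).card * D)) <
      (((q.patternTuples p I x j).filter fun t =>
        HashesTo S x (q.residualVars x j) y (q.valueAt j t) ω).card : ℝ) with hbad
  set E := Real.exp (-(D : ℝ)) * Fintype.card (HashFamily S n) with hE
  have hE0 : 0 ≤ E := by positivity
  have hbound : ∀ x j y, ((bad x j y).card : ℝ) ≤ E := fun x j y =>
    card_hash_count_gt_le hp S x (q.residualVars x j) y (q.valueAt j) (q.patternTuples p I x j)
      (I j).card (Finset.card_le_card (Finset.filter_subset _ _)) (prod_share_le S x _)
      (fun s hs v hv => q.mul_card_filter_valueAt_le I x j hs hv) D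
  have hsub : (Finset.univ.filter fun ω : HashFamily S n => q.Overloaded S I D ω) ⊆
      Finset.univ.biUnion fun x => Finset.univ.biUnion fun j =>
        Finset.univ.biUnion fun y => bad x j y := by
    intro ω hω
    obtain ⟨x, j, y, h⟩ := (Finset.mem_filter.1 hω).2
    simp only [Finset.mem_biUnion, Finset.mem_univ, true_and]
    exact ⟨x, j, y, Finset.mem_filter.2 ⟨Finset.mem_univ _, h⟩⟩
  -- The hypercube of `x` has at most `p` points, being embedded into the servers.
  have hy : ∀ x j, ((Finset.univ.biUnion fun y => bad x j y).card : ℝ) ≤ p * E := by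
    intro x j
    calc ((Finset.univ.biUnion fun y => bad x j y).card : ℝ)
        ≤ ∑ y, ((bad x j y).card : ℝ) := by exact_mod_cast Finset.card_biUnion_le
      _ ≤ ∑ _y : (∀ v, Fin (S.share x v)), E := Finset.sum_le_sum fun y _ => hbound x j y
      _ = (∏ v, S.share x v : ℕ) * E := by
          rw [Finset.sum_const, nsmul_eq_mul, Finset.card_univ, Fintype.card_pi]; simp
      _ ≤ p * E := mul_le_mul_of_nonneg_right (Nat.cast_le.2 (prod_share_le S x _)) hE0
  have hj : ∀ x, ((Finset.univ.biUnion fun j => Finset.univ.biUnion fun y => bad x j y).card : ℝ) ≤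
      ℓ * (p * E) := by
    intro x
    calc _ ≤ ∑ j, ((Finset.univ.biUnion fun y => bad x j y).card : ℝ) := by
          exact_mod_cast Finset.card_biUnion_le
      _ ≤ ∑ _j : Fin ℓ, p * E := Finset.sum_le_sum fun j _ => hy x j
      _ = ℓ * (p * E) := by simp
  calc _ ≤ ((Finset.univ.biUnion fun x => Finset.univ.biUnion fun j =>
        Finset.univ.biUnion fun y => bad x j y).card : ℝ) := Nat.cast_le.2 (Finset.card_le_card hsub)
    _ ≤ ∑ x, ((Finset.univ.biUnion fun j =>
          Finset.univ.biUnion fun y => bad x j y).card : ℝ) := by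
        exact_mod_cast Finset.card_biUnion_le
    _ ≤ ∑ _x : Finset (Fin k), ℓ * (p * E) := Finset.sum_le_sum fun x _ => hj x
    _ = _ := by
        rw [Finset.sum_const, nsmul_eq_mul, Finset.card_univ, Fintype.card_finset, Fintype.card_fin,
          hE]
        push_cast; ring

/-- The factor between the load and `(1 + k D) L_max` outside of the event `Overloaded`. -/
noncomputable def loadFactor (q : FullCQ k ℓ) : ℝ :=
  ℓ * (2 ^ k * ((ℓ + 1) * (Real.exp 1 * 2 ^ (k + 1) + (∑ i, q.arity i : ℕ) ^ (∑ i, q.arity i))))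

theorem maxLoad_le_of_not_overloaded (q : FullCQ k ℓ) {n p : ℕ} (hn : 2 ≤ n) (hp : 0 < p)
    (S : HyperCubeFamily k p) (I : q.Database n) {m : Fin ℓ → ℕ} (hm : ∀ j, (I j).card = m j)
    (hS : ∀ x, ∀ j ∈ q.residualAtoms x, (q.sizeBits n m j : ℝ) ≤
      2 ^ (k + 1) * q.residualLoad x (fun i => (q.sizeBits n m i : ℝ)) p *
        ((∏ v ∈ q.residualVars x j, S.share x v : ℕ) : ℝ))
    (hL : ∀ j, (q.arity j : ℝ) * (p : ℝ) ^ q.arity j * (Nat.clog 2 n : ℝ) ≤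
      q.maxResidualLoad (fun i => (q.sizeBits n m i : ℝ)) p)
    (owner : q.Placement n p) (D : ℕ) {ω : HashFamily S n} (hω : ¬ q.Overloaded S I D ω) :
    ((q.hyperCube n S).maxLoad I owner ω : ℝ) ≤
      q.loadFactor * (1 + k * D) * q.maxResidualLoad (fun i => (q.sizeBits n m i : ℝ)) p := by
  classical
  set L := q.maxResidualLoad (fun i => (q.sizeBits n m i : ℝ)) p with hLdef
  have hL0 : 0 ≤ L := q.maxResidualLoad_nonneg (fun i => Nat.cast_nonneg _) p
  have hclog : 1 ≤ Nat.clog 2 n := Nat.clog_pos (by norm_num) hn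
  set A : ℕ := ∑ i, q.arity i with hA
  set W : ℝ := Real.exp 1 * 2 ^ (k + 1) + (A : ℝ) ^ A with hW
  have hW0 : 0 ≤ W := by positivity
  simp only [Overloaded, not_exists, not_lt] at hω
  -- The number of tuples of `S_j` that a server receives in the instance of `x`.
  set b : Fin ℓ → Finset (Fin k) → ℝ := fun j x =>
    if q.residualVars x j = ∅ then ((A : ℝ) * p) ^ q.arity j else
      Real.exp 1 * ((m j : ℝ) / ((∏ v ∈ q.residualVars x j, S.share x v : ℕ) : ℝ) *
        (1 + (q.residualVars x j).card * D)) with hb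
  have hb0 : ∀ j x, 0 ≤ b j x := by
    intro j x; simp only [hb]; split_ifs <;> positivity
  have hbits : ∀ j x, (q.arity j : ℝ) * Nat.clog 2 n * b j x ≤ W * (1 + k * D) * L := by
    intro j x
    simp only [hb]
    have hkD : (0 : ℝ) ≤ k * D := by positivity
    split_ifs with hx
    · have hA1 : q.arity j ≤ A := Finset.single_le_sum (f := q.arity) (by simp) (Finset.mem_univ j)
      have hA2 : (1 : ℝ) ≤ A := by exact_mod_cast (q.arity_pos j).trans_le hA1
      calc (q.arity j : ℝ) * Nat.clog 2 n * ((A : ℝ) * p) ^ q.arity j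
          = (A : ℝ) ^ q.arity j * (q.arity j * (p : ℝ) ^ q.arity j * Nat.clog 2 n) := by
            rw [mul_pow]; ring
        _ ≤ (A : ℝ) ^ A * L := by
            refine mul_le_mul (pow_le_pow_right₀ hA2 hA1) (hL j) (by positivity) (by positivity)
        _ ≤ W * (1 + k * D) * L := by
            refine mul_le_mul_of_nonneg_right ?_ hL0
            have h1 : (A : ℝ) ^ A ≤ W := le_add_of_nonneg_left (by positivity)
            nlinarith [mul_nonneg hW0 hkD]
    · set P : ℝ := ((∏ v ∈ q.residualVars x j, S.share x v : ℕ) : ℝ) with hP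
      have hP0 : 0 < P := Nat.cast_pos.2 (Finset.prod_pos fun v _ => S.share_pos x v)
      have h1 : (q.sizeBits n m j : ℝ) / P ≤ 2 ^ (k + 1) * L := by
        rw [div_le_iff₀ hP0]
        refine (hS x j (mem_residualAtoms.2 (Finset.nonempty_iff_ne_empty.2 hx))).trans ?_
        gcongr
        exact q.residualLoad_le_maxResidualLoad x _ p
      have h2 : ((q.residualVars x j).card : ℝ) ≤ k := by
        simpa using Finset.card_le_univ (q.residualVars x j)
      calc (q.arity j : ℝ) * Nat.clog 2 n *
            (Real.exp 1 * ((m j : ℝ) / P * (1 + (q.residualVars x j).card * D)))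
          = Real.exp 1 * ((q.sizeBits n m j : ℝ) / P) *
              (1 + (q.residualVars x j).card * D) := by
            simp only [sizeBits]; push_cast; ring
        _ ≤ Real.exp 1 * (2 ^ (k + 1) * L) * (1 + k * D) := by gcongr
        _ = Real.exp 1 * 2 ^ (k + 1) * ((1 + k * D) * L) := by ring
        _ ≤ W * ((1 + k * D) * L) := by
            refine mul_le_mul_of_nonneg_right ?_ (by positivity)
            exact le_add_of_nonneg_right (by positivity)
        _ = _ := by ring
  have hsent : ∀ s' j, (((I j).filter fun t =>
      q.SentTo S ω (q.heavyHitters p I) j t s').card : ℝ) ≤ ∑ x, b j x := by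
    intro s' j
    refine q.card_sentTo_le_sum S I ω j s' (hb0 j) fun x y => ?_
    simp only [hb]
    split_ifs with hx
    · refine le_trans (Nat.cast_le.2 (Finset.card_le_card (Finset.filter_subset _ _))) ?_
      exact_mod_cast q.card_patternTuples_le_of_residualVars_eq_empty p I hx
    · rw [← hm j]
      exact hω x j y
  have hcode : ∀ j : Fin ℓ, ((j + 1 + q.arity j * Nat.clog 2 n : ℕ) : ℝ) ≤
      (ℓ + 1) * (q.arity j * Nat.clog 2 n) := by
    intro j
    have h1 : 1 ≤ q.arity j * Nat.clog 2 n := Nat.mul_pos (q.arity_pos j) hclog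
    have h2 : (j : ℕ) + 1 + q.arity j * Nat.clog 2 n ≤ (ℓ + 1) * (q.arity j * Nat.clog 2 n) := by
      have := j.2
      nlinarith
    exact_mod_cast h2
  have hserver : ∀ s', ((∑ s, ((q.hyperCube n S).message I owner ω s s').length : ℕ) : ℝ) ≤
      q.loadFactor * (1 + k * D) * L := by
    intro s'
    rw [sum_length_message]
    calc _ = ∑ j, (((I j).filter fun t => q.SentTo S ω (q.heavyHitters p I) j t s').card : ℝ) *
          ((j + 1 + q.arity j * Nat.clog 2 n : ℕ) : ℝ) := by push_cast; rfl
      _ ≤ ∑ j, (∑ x, b j x) * ((ℓ + 1) * (q.arity j * Nat.clog 2 n)) := by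
          refine Finset.sum_le_sum fun j _ => mul_le_mul (hsent s' j) (hcode j) (by positivity)
            (Finset.sum_nonneg fun x _ => hb0 j x)
      _ = ∑ j, ∑ x, (ℓ + 1) * (q.arity j * Nat.clog 2 n * b j x) := by
          refine Finset.sum_congr rfl fun j _ => ?_
          rw [Finset.sum_mul]
          exact Finset.sum_congr rfl fun x _ => by ring
      _ ≤ ∑ _j : Fin ℓ, ∑ _x : Finset (Fin k), (ℓ + 1) * (W * (1 + k * D) * L) := by
          refine Finset.sum_le_sum fun j _ => Finset.sum_le_sum fun x _ => ?_
          exact mul_le_mul_of_nonneg_left (hbits j x) (by positivity)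
      _ = q.loadFactor * (1 + k * D) * L := by
          simp only [Finset.sum_const, Finset.card_univ, Fintype.card_fin, Fintype.card_finset,
            nsmul_eq_mul, loadFactor, ← hA, ← hW]
          push_cast; ring
  have hmax : (q.hyperCube n S).maxLoad I owner ω = Finset.univ.sup fun s' =>
      ∑ s, ((q.hyperCube n S).message I owner ω s s').length := rfl
  rw [hmax]
  obtain ⟨s', -, hs'⟩ := Finset.exists_mem_eq_sup Finset.univ ⟨⟨0, hp⟩, Finset.mem_univ _⟩
    fun s' => ∑ s, ((q.hyperCube n S).message I owner ω s s').length
  rw [hs']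
  exact hserver s'

open Classical in
theorem prob_hyperCube_le (q : FullCQ k ℓ) {n p : ℕ} (S : HyperCubeFamily k p)
    {E E' : HashFamily S n → Prop} (h : ∀ ω, E ω → E' ω) {ε : ℝ}
    (hE' : ((Finset.univ.filter E').card : ℝ) ≤ ε * Fintype.card (HashFamily S n)) :
    (q.hyperCube n S).prob E ≤ ε := by
  have hne : Nonempty (HashFamily S n) := (q.hyperCube n S).seedNonempty
  have hpos : (0 : ℝ) < Fintype.card (HashFamily S n) := Nat.cast_pos.2 Fintype.card_pos
  change (Nat.card {ω : HashFamily S n // E ω} : ℝ) / (Nat.card (HashFamily S n) : ℝ) ≤ ε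
  rw [Nat.card_eq_fintype_card, Nat.card_eq_fintype_card, div_le_iff₀ hpos, Fintype.card_subtype]
  refine le_trans (Nat.cast_le.2 (Finset.card_le_card fun ω hω => ?_)) hE'
  exact Finset.mem_filter.2 ⟨Finset.mem_univ _, h ω (Finset.mem_filter.1 hω).2⟩

end FullCQ

/-! ### The load bound -/

theorem mainTheorem1 {k ℓ : ℕ} (q : FullCQ k ℓ) :
    ∃ (S : ∀ p : ℕ, 0 < p → ∀ _n : ℕ, ∀ _m : Fin ℓ → ℕ, FullCQ.HyperCubeFamily k p) (c : ℕ),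
    ∀ γ : ℝ, 0 < γ → ∃ C : ℝ, 0 < C ∧
    ∀ (p : ℕ) (hp : 0 < p) (n : ℕ), 2 ≤ n → ∀ (m : Fin ℓ → ℕ),
      -- a set of `p ^ a_j` tuples of `S_j` does not exceed the load bound
      (∀ j, (q.arity j : ℝ) * (p : ℝ) ^ q.arity j * (Nat.clog 2 n : ℝ) ≤
        q.maxResidualLoad (fun i => (q.sizeBits n m i : ℝ)) p) →
      ∀ (I : q.Database n), (∀ j, (I j).card = m j) → ∀ (owner : q.Placement n p),
        (∀ ω, (q.hyperCube n (S p hp n m)).result I owner ω = q.answer I) ∧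
        (q.hyperCube n (S p hp n m)).prob (fun ω =>
            C * (1 + Real.log p) ^ c * q.maxResidualLoad (fun i => (q.sizeBits n m i : ℝ)) p <
              ((q.hyperCube n (S p hp n m)).maxLoad I owner ω : ℝ)) ≤ (p : ℝ) ^ (-γ) ∧
        ∀ M : ℕ, (∀ j, q.sizeBits n m j = M) →
          (q.hyperCube n (S p hp n m)).prob (fun ω =>
            C * (1 + Real.log p) ^ c * ((M : ℝ) / (p : ℝ) ^ (1 / q.quasiPackingNumber)) <
              ((q.hyperCube n (S p hp n m)).maxLoad I owner ω : ℝ)) ≤ (p : ℝ) ^ (-γ) := by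
  have hM : ∀ (n : ℕ) (m : Fin ℓ → ℕ) (j : Fin ℓ), (0 : ℝ) ≤ (q.sizeBits n m j : ℝ) :=
    fun n m j => Nat.cast_nonneg _
  choose S hS using fun (p : ℕ) (hp : 0 < p) (n : ℕ) (m : Fin ℓ → ℕ) =>
    q.exists_hyperCubeFamily (hM n m) hp
  refine ⟨S, 1, fun γ hγ => ?_⟩
  have hU1 : (1 : ℝ) ≤ 2 ^ k * (ℓ + 1) :=
    one_le_mul_of_one_le_of_one_le (one_le_pow₀ one_le_two) (by simp)
  set G : ℝ := Real.log (2 ^ k * (ℓ + 1)) + 1 with hG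
  have hG0 : 0 ≤ G := add_nonneg (Real.log_nonneg hU1) zero_le_one
  have hF0 : 0 ≤ q.loadFactor := by unfold FullCQ.loadFactor; positivity
  refine ⟨q.loadFactor * (1 + k * (γ + 1 + G)) + 1, by positivity, ?_⟩
  intro p hp n hn m hL I hm owner
  have hp0 : (0 : ℝ) < p := by exact_mod_cast hp
  have hlog : 0 ≤ Real.log p := Real.log_nonneg (by exact_mod_cast hp)
  set L := q.maxResidualLoad (fun i => (q.sizeBits n m i : ℝ)) p with hLdef
  have hL0 : 0 ≤ L := q.maxResidualLoad_nonneg (hM n m) p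
  -- This makes the union bound over the `2 ^ k ℓ p` points of all the hypercubes work.
  set D : ℕ := ⌈(γ + 1) * Real.log p + Real.log (2 ^ k * (ℓ + 1))⌉₊ with hD
  have hDle : (D : ℝ) ≤ (γ + 1) * Real.log p + G := by
    have := Nat.ceil_lt_add_one (a := (γ + 1) * Real.log p + Real.log (2 ^ k * (ℓ + 1)))
      (add_nonneg (by positivity) (Real.log_nonneg hU1))
    rw [hG]; linarith
  have hexp : 2 ^ k * ℓ * p * Real.exp (-(D : ℝ)) ≤ (p : ℝ) ^ (-γ) := by
    have h1 : Real.exp (-(D : ℝ)) ≤ (p : ℝ) ^ (-γ) / (2 ^ k * (ℓ + 1) * p) := by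
      have h2 : (p : ℝ) ^ (-γ) / (2 ^ k * (ℓ + 1) * p) =
          Real.exp (-((γ + 1) * Real.log p + Real.log (2 ^ k * (ℓ + 1)))) := by
        rw [Real.rpow_def_of_pos hp0, neg_add, Real.exp_add, Real.exp_neg (Real.log _),
          Real.exp_log (by positivity), add_mul, neg_add, Real.exp_add, one_mul,
          Real.exp_neg (Real.log _), Real.exp_log hp0, mul_neg, mul_comm γ]
        field_simp
      rw [h2]
      exact Real.exp_le_exp.2 (neg_le_neg (Nat.le_ceil _))
    rw [le_div_iff₀ (by positivity)] at h1
    refine le_trans ?_ h1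
    have : (0 : ℝ) ≤ 2 ^ k * p * Real.exp (-(D : ℝ)) := by positivity
    nlinarith
  have hfactor : q.loadFactor * (1 + k * D) * L ≤
      (q.loadFactor * (1 + k * (γ + 1 + G)) + 1) * (1 + Real.log p) ^ 1 * L := by
    refine mul_le_mul_of_nonneg_right ?_ hL0
    have h1 : (1 : ℝ) + k * D ≤ (1 + k * (γ + 1 + G)) * (1 + Real.log p) := by
      have h2 : (D : ℝ) ≤ (γ + 1 + G) * (1 + Real.log p) := by
        nlinarith [mul_nonneg hG0 hlog]
      have h3 := mul_le_mul_of_nonneg_left h2 (Nat.cast_nonneg (α := ℝ) k)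
      nlinarith
    have h4 := mul_le_mul_of_nonneg_left h1 hF0
    rw [pow_one]
    nlinarith
  have hload : ∀ B : ℝ, L ≤ B → (q.hyperCube n (S p hp n m)).prob (fun ω =>
      (q.loadFactor * (1 + k * (γ + 1 + G)) + 1) * (1 + Real.log p) ^ 1 * B <
        ((q.hyperCube n (S p hp n m)).maxLoad I owner ω : ℝ)) ≤ (p : ℝ) ^ (-γ) := by
    intro B hB
    refine q.prob_hyperCube_le (S p hp n m) (E' := q.Overloaded (S p hp n m) I D)
      (fun ω hω => ?_) ((q.card_overloaded_le hp (S p hp n m) I D).trans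
        (mul_le_mul_of_nonneg_right hexp (Nat.cast_nonneg _)))
    by_contra hno
    refine absurd hω (not_lt.2 ?_)
    refine (q.maxLoad_le_of_not_overloaded hn hp (S p hp n m) I hm (hS p hp n m) hL owner D hno).trans
      (hfactor.trans ?_)
    gcongr
  refine ⟨fun ω => q.hyperCube_result _ I owner ω, hload L le_rfl, fun M hMeq => hload _ ?_⟩
  exact q.maxResidualLoad_le_of_le (hM n m) (fun j => by rw [hMeq j]) (Nat.cast_nonneg M) hp
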